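/- Let $n$ be a positive integer such that $p=2n-1$ is a prime with $p\equiv 1 \pmod 4$. Let $Q_p\subset \mathbb{Z}_p^*=\mathbb{Z}_p\setminus\{0\}$ be the group of quadratic residues modulo $p$, so that $|Q_p|=(p-1)/2=n-1$. Let $\mathbb{C}^n$ have the orthonormal basis $\hat e_0$, $\hat e_q$ ($q\in Q_p$), and for $N\in\mathbb{R}$ and $a\in\mathbb{Z}_p$ put the (unnormalized) vector $$|Q(a)\rangle = N\,\hat e_0+\sum_{q\in Q_p} e^{2\pi i q a/p}\,\hat e_q\in\mathbb{C}^n .$$ For $d \in \mathbb{Z}_p$ let $s(d)=\sum_{q\in Q_p}e^{2\pi i q d/p}$. There is a real number $N$ with $$(N^2+s(b-a))\,(N^2-1-s(b-a))=0\qquad\text{for all } a\neq b \text{ in } \mathbb{Z}_p, \tag{$*$}$$ and for every real solution $N$ of $(*)$ and every quadratic nonresidue $x\in\mathbb{Z}_p^*\setminus Q_p$, the states $$|Q(a)\rangle\otimes|Q(xa)\rangle,\qquad a\in\mathbb{Z}_p,$$ are $p=2n-1$ distinct states that form a minimal unextendible product basis (UPB) of $\mathbb{C}^n\otimes\mathbb{C}^n$.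 Here a pure state is represented by a nonzero vector, up to scalars. A set $S$ of pairwise orthogonal product states (nonzero vectors $u\otimes v$) is a UPB if the orthogonal complement $\mathcal{H}_S^\perp$ of its span contains fewer mutually orthogonal product states than its dimension (so in particular $\mathcal{H}_S^\perp\neq 0$) and contains no product state at all. A UPB is minimal if no UPB of the same space has fewer members. -/

import Mathlib

open scoped TensorProduct

/-! ### Product bases of a bipartite space

The local spaces are meant to be finite-dimensional. A pure state is a ray; it is represented here by any nonzero vector of that ray. -/

noncomputable section ProductBases

variable {A B : Type*} [NormedAddCommGroup A] [InnerProductSpace ℂ A]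
  [NormedAddCommGroup B] [InnerProductSpace ℂ B]

/-- A (not necessarily normalized) pure product state of the bipartite space `A ⊗ B`. -/
def IsProductState (ψ : A ⊗[ℂ] B) : Prop :=
  ψ ≠ 0 ∧ ∃ (u : A) (v : B), ψ = u ⊗ₜ[ℂ] v

/-- An orthogonal product basis (PB): a set of mutually orthogonal pure product states.
It need not span the whole space. -/
def IsPB (S : Set (A ⊗[ℂ] B)) : Prop :=
  (∀ ψ ∈ S, IsProductState ψ) ∧ S.Pairwise fun ψ φ => inner ℂ ψ φ = 0

/-- The complementary subspace of `S`: all vectors orthogonal to the span of `S`. -/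
def complementarySubspace (S : Set (A ⊗[ℂ] B)) : Submodule ℂ (A ⊗[ℂ] B) :=
  (Submodule.span ℂ S)ᗮ

/-- An uncompletable product basis (UCPB): a PB whose complementary subspace contains fewer
mutually orthogonal product states than its dimension. -/
def IsUCPB (S : Set (A ⊗[ℂ] B)) : Prop :=
  IsPB S ∧ ∀ T : Set (A ⊗[ℂ] B), T ⊆ (complementarySubspace S : Set (A ⊗[ℂ] B)) → IsPB T →
    T.encard < (Module.finrank ℂ (complementarySubspace S) : ℕ∞)

/-- An unextendible product basis (UPB): a UCPB whose complementary subspace contains no product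
state. -/
def IsUPB (S : Set (A ⊗[ℂ] B)) : Prop :=
  IsUCPB S ∧ ∀ ψ ∈ complementarySubspace S, ¬ IsProductState ψ

/-- A minimal UPB: a UPB with the least number of members among all UPBs of the same space. -/
def IsMinimalUPB (S : Set (A ⊗[ℂ] B)) : Prop :=
  IsUPB S ∧ ∀ T : Set (A ⊗[ℂ] B), IsUPB T → S.encard ≤ T.encard

end ProductBases

/-! ### The quadratic-residue states -/

noncomputable section QuadraticResidueStates

/-- The quadratic residues `Q_p`: the nonzero squares modulo `p`. -/
abbrev QuadRes (p : ℕ) : Type := {q : ZMod p // q ≠ 0 ∧ IsSquare q}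

/-- `e^{2πi z / p}` for a class `z` modulo `p`. -/
def expMod (p : ℕ) (z : ZMod p) : ℂ :=
  Complex.exp (2 * Real.pi * Complex.I * (z.val : ℂ) / (p : ℂ))

/-- The local Hilbert space: one coordinate `none` for the entry `N`, and one coordinate `some q`,
with unit vector `ê_q`, for every quadratic residue `q`. -/
abbrev LocalSpace (p : ℕ) [NeZero p] : Type := EuclideanSpace ℂ (Option (QuadRes p))

/-- `|Q(a)⟩ = (N,0,…,0) + ∑_{q ∈ Q_p} e^{2πi q a / p} ê_q`. -/
def ketQ (p : ℕ) [NeZero p] (N : ℝ) (a : ZMod p) : LocalSpace p :=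
  EuclideanSpace.single none (N : ℂ) +
    ∑ q : QuadRes p, EuclideanSpace.single (some q) (expMod p (q.1 * a))

/-- The set of states `|Q(a)⟩ ⊗ |Q(xa)⟩`, `a ∈ ℤ_p`. -/
def quadResStates (p : ℕ) [NeZero p] (N : ℝ) (x : ZMod p) :
    Set (LocalSpace p ⊗[ℂ] LocalSpace p) :=
  Set.range fun a : ZMod p => ketQ p N a ⊗ₜ[ℂ] ketQ p N (x * a)

/-- The sum `s(d) = ∑_{q ∈ Q_p} e^{2πi q d / p}`. -/
def residueSum (p : ℕ) [NeZero p] (d : ZMod p) : ℂ :=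
  ∑ q : QuadRes p, expMod p (q.1 * d)

/-- `N` solves `(N² + s(b-a)) (N² - 1 - s(b-a)) = 0` for all `a ≠ b`. -/
def SolvesOrthogonality (p : ℕ) [NeZero p] (N : ℝ) : Prop :=
  ∀ a b : ZMod p, a ≠ b →
    ((N : ℂ) ^ 2 + residueSum p (b - a)) * ((N : ℂ) ^ 2 - 1 - residueSum p (b - a)) = 0

end QuadraticResidueStates

-- Minors of the Fourier matrix of prime order

section FourierMinors

open Polynomial

-- Orthogonality: the local inner products for `a ≠ b` are `N² + s(d)` and `N² + s(xd)` with `d = b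
-- - a`. Since `s(d) + s(xd) = -1`, their product is the left side of `(*)`; since `s(d) s(xd) = (1
-- - p)/4` by the quadratic Gauss sum, `(*)` is one quadratic equation in `N²`, independent of `d`.
--
-- Unextendibility: the vectors `|Q(a)⟩` are, up to the weight `N ≠ 0`, rows of `n` columns of the
-- Fourier matrix, so by Chebotarev's theorem any `n` of them span. If `u ⊗ v` is orthogonal to all
-- `2n - 1` states, then `u` or `v` is orthogonal to `n` local vectors and vanishes.
--
-- Minimality: at most `2n - 2` product states split into two groups of at most `n - 1`; some `u ≠
-- 0` kills the first factors of one group, some `v ≠ 0` the second factors of the other, and `u ⊗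
-- v` extends the set.

/-- A polynomial of degree less than `p` with at most `m` terms, over a field of
characteristic `p`, is zero as soon as `(X - 1) ^ m` divides it. -/
theorem eq_zero_of_X_sub_one_pow_dvd_sum {k : Type*} [Field k] {p : ℕ} [Fact p.Prime] [CharP k p]
    (J : Finset (ZMod p)) (c : ZMod p → k) {m : ℕ} (hm : J.card ≤ m)
    (h : (X - 1 : k[X]) ^ m ∣ ∑ j ∈ J, C (c j) * X ^ j.val) : ∀ j ∈ J, c j = 0 := by
  -- The operator `X · d/dX` multiplies the coefficient of `X ^ j` by `j` and costs at most one
  -- factor `X - 1`.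
  have key : ∀ i ≤ m, (X - 1 : k[X]) ^ (m - i) ∣
      ∑ j ∈ J, C (c j * (j.val : k) ^ i) * X ^ j.val := by
    intro i
    induction i with
    | zero => simpa using h
    | succ i ih =>
      intro hi
      have h1 := (pow_sub_one_dvd_derivative_of_pow_dvd (ih (by omega))).mul_left X
      rw [Nat.sub_sub] at h1
      convert h1 using 1
      rw [derivative_sum, Finset.mul_sum]
      refine Finset.sum_congr rfl fun j _ => ?_
      rw [derivative_C_mul, derivative_X_pow]
      rcases Nat.eq_zero_or_pos j.val with h0 | h0
      · simp [h0]
      · rw [show X * (C (c j * (j.val : k) ^ i) * (C (j.val : k) * X ^ (j.val - 1))) =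
          C (c j * (j.val : k) ^ i) * C (j.val : k) * (X ^ (j.val - 1) * X) by ring, ← C_mul,
          ← pow_succ, Nat.sub_add_cancel h0, pow_succ, mul_assoc]
  have hsum : ∀ i < m, ∑ j ∈ J, c j * (j.val : k) ^ i = 0 := by
    intro i hi
    have h1 : (X - 1 : k[X]) ∣ _ := (dvd_pow_self _ (by omega)).trans (key i hi.le)
    rw [← C_1, dvd_iff_isRoot, IsRoot.def] at h1
    simpa [eval_finsetSum] using h1
  let e := J.equivFin.symm
  have hinj : Function.Injective fun i : Fin J.card => (((e i : ZMod p).val : ℕ) : k) := by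
    intro i j hij
    have h2 := (CharP.natCast_eq_natCast k p).1 hij
    rw [Nat.ModEq, Nat.mod_eq_of_lt (ZMod.val_lt _), Nat.mod_eq_of_lt (ZMod.val_lt _)] at h2
    exact e.injective (Subtype.ext (ZMod.val_injective p h2))
  -- Evaluation at `1` gave a Vandermonde system; its nodes `j.val` stay distinct in characteristic
  -- `p`.
  have hv := Matrix.eq_zero_of_forall_pow_sum_mul_pow_eq_zero (f := fun i : Fin J.card =>
    (((e i : ZMod p).val : ℕ) : k)) (v := fun i => c (e i)) hinj (fun i => by
      rw [← hsum i (i.2.trans_le hm), ← Finset.sum_coe_sort J]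
      exact Equiv.sum_comp e fun j : J => c j * ((j : ZMod p).val : k) ^ (i : ℕ))
  intro j hj
  simpa [e] using congrFun hv (J.equivFin ⟨j, hj⟩)

/-- There is a valuation subring of `ℂ` whose residue field has characteristic `p`. -/
theorem exists_valuationSubring_complex_charP (p : ℕ) [hp : Fact p.Prime] :
    ∃ B : ValuationSubring ℂ, CharP (IsLocalRing.ResidueField B) p := by
  let f := (Int.castRingHom ℂ).rangeRestrict
  have hf : Function.Bijective f :=
    ⟨fun a b hab => Int.cast_injective (α := ℂ) (congrArg Subtype.val hab),
      RingHom.rangeRestrict_surjective _⟩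
  let g := RingEquiv.ofBijective f hf
  have hI : Ideal.span {g p} ≠ ⊤ := by
    rw [Ne, Ideal.span_singleton_eq_top]
    intro hu
    have h1 : IsUnit (p : ℤ) := by simpa using hu.map g.symm
    exact hp.out.one_lt.ne' (by simpa [Int.isUnit_iff] using Int.isUnit_iff_natAbs_eq.1 h1)
  -- A proper ideal of a subring lies in the nonunits of some valuation ring; here the ideal is
  -- `(p)` in the copy of `ℤ`.
  obtain ⟨B, hB, hBI⟩ := Ideal.image_subset_nonunits_valuationSubring _ hI
  refine ⟨B, ?_⟩
  have hpB : (p : ℂ) ∈ B.nonunits := hBI ⟨g p, Ideal.mem_span_singleton_self _, by simp⟩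
  refine (CharP.charP_iff_prime_eq_zero hp.out).2 ?_
  rw [← map_natCast (IsLocalRing.residue B), IsLocalRing.residue_eq_zero_iff]
  obtain ⟨h1, h2⟩ := ValuationSubring.mem_nonunits_iff_exists_mem_maximalIdeal.1 hpB
  convert h2
  simp

/-- **Chebotarev's theorem on roots of unity**: for `p` prime, every square submatrix of the
Fourier matrix of order `p` is nonsingular. -/
theorem eq_zero_of_forall_sum_stdAddChar_eq_zero {p : ℕ} [hp : Fact p.Prime]
    (J A : Finset (ZMod p)) (hJA : J.card ≤ A.card) (c : ZMod p → ℂ)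
    (h : ∀ a ∈ A, ∑ j ∈ J, c j * ZMod.stdAddChar (j * a) = 0) : ∀ j ∈ J, c j = 0 := by
  obtain ⟨B, hB⟩ := exists_valuationSubring_complex_charP p
  by_contra! hne
  obtain ⟨j₁, hj₁, hc₁⟩ := hne
  -- Dividing by a coefficient of maximal valuation puts all coefficients in `B` and makes one equal
  -- to `1`, so the reduction is nonzero.
  obtain ⟨j₀, hj₀, hmax⟩ := J.exists_max_image (fun j => B.valuation (c j)) ⟨j₁, hj₁⟩
  have hc₀ : c j₀ ≠ 0 := by
    intro h0
    have := hmax j₁ hj₁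
    simp [h0, hc₁] at this
  have hmem : ∀ j ∈ J, c j / c j₀ ∈ B := by
    intro j hj
    rw [← B.valuation_le_one_iff, map_div₀]
    exact div_le_one_of_le₀ (hmax j hj) zero_le
  have hω : ∀ a : ZMod p, ZMod.stdAddChar a ^ p = (1 : ℂ) := by
    intro a
    rw [← AddChar.map_nsmul_eq_pow]
    simp
  have hωB : ∀ a : ZMod p, (ZMod.stdAddChar a : ℂ) ∈ B := by
    intro a
    rw [← B.valuation_le_one_iff, ← pow_le_one_iff_of_nonneg zero_le hp.out.ne_zero, ← map_pow, hω,
      map_one]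
  classical
  let c' : ZMod p → B := fun j => if hj : j ∈ J then ⟨c j / c j₀, hmem j hj⟩ else 0
  let ω : ZMod p → B := fun a => ⟨ZMod.stdAddChar a, hωB a⟩
  have hωinj : Function.Injective ω := fun a b hab =>
    ZMod.injective_stdAddChar (congrArg (Subtype.val : B → ℂ) hab)
  let f : B[X] := ∑ j ∈ J, C (c' j) * X ^ j.val
  have hroot : ∀ a ∈ A, f.IsRoot (ω a) := by
    intro a ha
    rw [IsRoot.def]
    apply Subtype.ext
    have h1 : ((f.eval (ω a) : B) : ℂ) = ∑ j ∈ J, c j / c j₀ * ZMod.stdAddChar (j * a) := by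
      simp only [f, eval_finsetSum, eval_mul, eval_C, eval_pow, eval_X]
      push_cast
      refine Finset.sum_congr rfl fun j hj => ?_
      simp only [c', hj, dif_pos, ω]
      rw [← AddChar.map_nsmul_eq_pow]
      simp
    rw [h1]
    simp_rw [div_mul_eq_mul_div]
    rw [← Finset.sum_div, h a ha]
    simp
  have hdvd : ∏ a ∈ A, (X - C (ω a)) ∣ f := by
    by_cases hf : f = 0
    · simp [hf]
    have hle : A.val.map ω ≤ f.roots := by
      rw [Multiset.le_iff_subset (A.nodup.map hωinj)]
      intro b hb
      obtain ⟨a, ha, rfl⟩ := Multiset.mem_map.1 hb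
      exact (mem_roots hf).2 (hroot a ha)
    have := (Multiset.prod_X_sub_C_dvd_iff_le_roots hf _).2 hle
    rwa [Multiset.map_map] at this
  -- All `p`-th roots of unity reduce to `1`, so the distinct roots `ω a` merge into a factor `(X -
  -- 1) ^ A.card`.
  have hres : ∀ a, IsLocalRing.residue B (ω a) = 1 := by
    intro a
    have h1 : ω a ^ p = 1 := Subtype.ext (hω a)
    have h2 : IsLocalRing.residue B (ω a) ^ p = 1 := by rw [← map_pow, h1, map_one]
    have := (frobenius_inj (IsLocalRing.ResidueField B) p)
    apply this
    simpa [frobenius_def] using h2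
  have hdvd' := Polynomial.map_dvd (IsLocalRing.residue B) hdvd
  have h0 := eq_zero_of_X_sub_one_pow_dvd_sum J (fun j => IsLocalRing.residue B (c' j)) hJA
    (by simpa [f, Polynomial.map_prod, Polynomial.map_sum, hres] using hdvd') j₀ hj₀
  have h1 : c' j₀ = 1 := Subtype.ext (by simp [c', hj₀, hc₀])
  simp [h1] at h0

end FourierMinors

-- Quadratic residue sums and the equation for `N`

section ResidueSums

theorem expMod_eq_stdAddChar {p : ℕ} [NeZero p] (z : ZMod p) :
    expMod p z = ZMod.stdAddChar z := by
  rw [expMod, ZMod.stdAddChar_apply, ZMod.toCircle_apply]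

variable {p : ℕ} [hp : Fact p.Prime]

/-- If `x` is a nonresidue, the field splits into `0`, the residues, and their multiples by `x`. -/
theorem sum_quadRes_add_sum_quadRes_mul {M : Type*} [AddCommMonoid M] {x : ZMod p}
    (hx : ¬ IsSquare x) (f : ZMod p → M) :
    f 0 + (∑ q : QuadRes p, f q + ∑ q : QuadRes p, f (x * q)) = ∑ z, f z := by
  classical
  have hx0 : x ≠ 0 := fun h => hx (h ▸ IsSquare.zero)
  let S : Finset (ZMod p) := {q | q ≠ 0 ∧ IsSquare q}
  have hS : ∀ q, q ∈ S ↔ q ≠ 0 ∧ IsSquare q := by simp [S]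
  rw [← Finset.sum_filter_add_sum_filter_not Finset.univ (fun z : ZMod p => IsSquare z) f,
    ← Finset.sum_subtype S hS f, ← Finset.sum_subtype S hS fun q => f (x * q), ← add_assoc]
  congr 1
  · rw [← Finset.sum_insert (by simp [hS])]
    refine Finset.sum_congr ?_ fun _ _ => rfl
    ext z
    by_cases hz : z = 0 <;> simp [S, hz]
  · refine Finset.sum_nbij' (fun q => x * q) (fun z => x⁻¹ * z) ?_ ?_ ?_ ?_ fun _ _ => rfl
    · intro q hq
      obtain ⟨hq0, hq⟩ := (hS q).1 hq
      simp only [Finset.mem_filter, Finset.mem_univ, true_and]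
      intro h
      exact hx (by simpa [hq0] using h.mul hq.inv)
    · intro z hz
      simp only [Finset.mem_filter, Finset.mem_univ, true_and] at hz
      have hz0 : z ≠ 0 := fun h => hz (h ▸ IsSquare.zero)
      have hne : x⁻¹ * z ≠ 0 := mul_ne_zero (inv_ne_zero hx0) hz0
      refine (hS _).2 ⟨hne, ?_⟩
      rw [← quadraticChar_one_iff_isSquare hne, map_mul,
        quadraticChar_neg_one_iff_not_isSquare.2 hz,
        quadraticChar_neg_one_iff_not_isSquare.2 fun h => hx (by simpa using h.inv)]
      norm_num
    · intro q _
      simp [hx0]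
    · intro z _
      simp [hx0]

theorem two_mul_card_quadRes_add_one (hp2 : p ≠ 2) : 2 * Fintype.card (QuadRes p) + 1 = p := by
  obtain ⟨x, hx⟩ := FiniteField.exists_nonsquare (F := ZMod p) (by rwa [ZMod.ringChar_zmod_n])
  have := sum_quadRes_add_sum_quadRes_mul hx fun _ => 1
  simp only [Finset.sum_const, Finset.card_univ, ZMod.card, smul_eq_mul, mul_one] at this
  omega

theorem residueSum_add_residueSum_mul {x d : ZMod p} (hx : ¬ IsSquare x) (hd : d ≠ 0) :
    residueSum p d + residueSum p (x * d) = -1 := by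
  have h := sum_quadRes_add_sum_quadRes_mul hx fun z => (ZMod.stdAddChar (z * d) : ℂ)
  have h0 := AddChar.sum_mulShift d (ZMod.isPrimitive_stdAddChar p)
  rw [if_neg hd] at h0
  rw [h0] at h
  simp only [residueSum, expMod_eq_stdAddChar]
  simp only [zero_mul, AddChar.map_zero_eq_one, mul_comm x, mul_assoc] at h ⊢
  linear_combination h

/-- The difference `s(d) - s(xd)` is a Gauss sum with square `χ(-1) p = p`, as `-1` is a square.
Comparing with the square of the sum `-1` gives four times the product. -/
theorem residueSum_mul_residueSum_mul (hp4 : p % 4 = 1) {x d : ZMod p} (hx : ¬ IsSquare x)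
    (hd : d ≠ 0) : residueSum p d * residueSum p (x * d) = (1 - p) / 4 := by
  have hp2 : ringChar (ZMod p) ≠ 2 := by
    rw [ZMod.ringChar_zmod_n]
    omega
  let χ := (quadraticChar (ZMod p)).ringHomComp (Int.castRingHom ℂ)
  have hχ1 : χ ≠ 1 :=
    (MulChar.ringHomComp_ne_one_iff Int.cast_injective).2 (quadraticChar_ne_one hp2)
  have hneg : IsSquare (-1 : ZMod p) := ZMod.exists_sq_eq_neg_one_iff.2 (by omega)
  have hsq := gaussSum_sq hχ1 ((quadraticChar_isQuadratic (ZMod p)).comp _)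
    (ψ := ZMod.stdAddChar.mulShift d) fun b hb => by
      rw [AddChar.mulShift_mulShift]
      exact ZMod.isPrimitive_stdAddChar p (mul_ne_zero hd hb)
  have hχn : χ (-1) = 1 := by
    simp [χ, (quadraticChar_one_iff_isSquare (neg_ne_zero.2 one_ne_zero)).2 hneg]
  have hG : gaussSum χ (ZMod.stdAddChar.mulShift d) = residueSum p d - residueSum p (x * d) := by
    rw [gaussSum, ← sum_quadRes_add_sum_quadRes_mul hx, residueSum, residueSum, sub_eq_add_neg,
      ← Finset.sum_neg_distrib, MulChar.map_zero, zero_mul, zero_add]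
    congr 1 <;> refine Finset.sum_congr rfl fun q _ => ?_
    · simp [χ, (quadraticChar_one_iff_isSquare q.2.1).2 q.2.2, expMod_eq_stdAddChar, mul_comm]
    · have hχq : χ (x * q) = -1 := by
        rw [map_mul]
        simp [χ, (quadraticChar_one_iff_isSquare q.2.1).2 q.2.2,
          quadraticChar_neg_one_iff_not_isSquare.2 hx]
      rw [hχq, expMod_eq_stdAddChar, AddChar.mulShift_apply, neg_one_mul, mul_comm x, mul_left_comm,
        mul_comm x]
  rw [hG, hχn, ZMod.card] at hsq
  have hadd := residueSum_add_residueSum_mul hx hd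
  linear_combination (-1 / 4 : ℂ) * hsq + (1 / 4 : ℂ) *
    (residueSum p d + residueSum p (x * d) - 1) * hadd

/-- The condition on `N` does not depend on the pair of states: it is a quadratic equation
in `N ^ 2`. -/
theorem solvesOrthogonality_iff (hp4 : p % 4 = 1) (N : ℝ) :
    SolvesOrthogonality p N ↔ N ^ 4 - N ^ 2 + (1 - p) / 4 = 0 := by
  have hp2 : ringChar (ZMod p) ≠ 2 := by
    rw [ZMod.ringChar_zmod_n]
    omega
  obtain ⟨x, hx⟩ := FiniteField.exists_nonsquare hp2
  have key : ∀ d : ZMod p, d ≠ 0 →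
      ((N : ℂ) ^ 2 + residueSum p d) * ((N : ℂ) ^ 2 - 1 - residueSum p d) =
        ((N ^ 4 - N ^ 2 + (1 - p) / 4 : ℝ) : ℂ) := by
    intro d hd
    have h1 := residueSum_add_residueSum_mul hx hd
    have h2 := residueSum_mul_residueSum_mul hp4 hx hd
    push_cast
    linear_combination h2 - residueSum p d * h1
  constructor
  · intro h
    have := h 0 1 zero_ne_one
    rw [sub_zero, key 1 one_ne_zero] at this
    exact_mod_cast this
  · intro h a b hab
    rw [key _ (sub_ne_zero.2 hab.symm), h, Complex.ofReal_zero]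

theorem exists_solvesOrthogonality (hp4 : p % 4 = 1) : ∃ N : ℝ, SolvesOrthogonality p N := by
  -- `(1 + √p) / 2` is the positive root of `t² - t + (1 - p)/4`.
  refine ⟨√((1 + √p) / 2), (solvesOrthogonality_iff hp4 _).2 ?_⟩
  have h1 : √((1 + √p) / 2) ^ 2 = (1 + √p) / 2 := Real.sq_sqrt (by positivity)
  have h2 : √(p : ℝ) ^ 2 = p := Real.sq_sqrt (by positivity)
  rw [show √((1 + √p) / 2) ^ 4 = (√((1 + √p) / 2) ^ 2) ^ 2 by ring, h1]
  linear_combination h2 / 4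

theorem SolvesOrthogonality.ne_zero (hp4 : p % 4 = 1) {N : ℝ} (hN : SolvesOrthogonality p N) :
    N ≠ 0 := by
  rintro rfl
  have h := (solvesOrthogonality_iff hp4 _).1 hN
  have : (1 : ℝ) < p := by exact_mod_cast hp.out.one_lt
  norm_num at h
  linarith

end ResidueSums

-- General bounds and criteria for UPBs

section UnextendibleProductBases

variable {A B : Type*} [NormedAddCommGroup A] [InnerProductSpace ℂ A]
  [NormedAddCommGroup B] [InnerProductSpace ℂ B]

theorem mem_complementarySubspace_iff {S : Set (A ⊗[ℂ] B)} {ψ : A ⊗[ℂ] B} :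
    ψ ∈ complementarySubspace S ↔ ∀ φ ∈ S, inner ℂ φ ψ = 0 := by
  refine ⟨fun h φ hφ => (Submodule.mem_orthogonal _ _).1 h φ (Submodule.subset_span hφ),
    fun h => ?_⟩
  rw [complementarySubspace, Submodule.mem_orthogonal]
  intro φ hφ
  induction hφ using Submodule.span_induction with
  | mem φ hφ => exact h φ hφ
  | zero => exact inner_zero_left _
  | add φ χ _ _ h1 h2 => rw [inner_add_left, h1, h2, add_zero]
  | smul c φ _ h1 => rw [inner_smul_left, h1, mul_zero]

theorem tmul_ne_zero_of_ne_zero {u : A} {v : B} (hu : u ≠ 0) (hv : v ≠ 0) : u ⊗ₜ[ℂ] v ≠ 0 := by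
  rw [← norm_ne_zero_iff, TensorProduct.norm_tmul]
  exact mul_ne_zero (norm_ne_zero_iff.2 hu) (norm_ne_zero_iff.2 hv)

/-- Fewer vectors than the dimension are annihilated by some nonzero vector. -/
theorem exists_ne_zero_forall_inner_eq_zero [FiniteDimensional ℂ A] {ι : Type*} (s : Finset ι)
    (f : ι → A) (hs : s.card < Module.finrank ℂ A) :
    ∃ u : A, u ≠ 0 ∧ ∀ i ∈ s, inner ℂ (f i) u = 0 := by
  classical
  let K := Submodule.span ℂ (s.image f : Set A)
  have hK : Module.finrank ℂ K < Module.finrank ℂ A :=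
    ((finrank_span_finset_le_card _).trans Finset.card_image_le).trans_lt hs
  have hne : Kᗮ ≠ ⊥ := by
    intro h
    have := K.finrank_add_finrank_orthogonal
    rw [h, finrank_bot] at this
    omega
  obtain ⟨u, hu, hu0⟩ := Submodule.exists_mem_ne_zero_of_ne_bot hne
  exact ⟨u, hu0, fun i hi => (Submodule.mem_orthogonal _ _).1 hu _
    (Submodule.subset_span (Finset.mem_coe.2 (Finset.mem_image_of_mem f hi)))⟩

/-- A product basis with at most `dim A + dim B - 2` members can be extended by a product state. -/
theorem IsUPB.finrank_add_finrank_le_encard [FiniteDimensional ℂ A] [FiniteDimensional ℂ B]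
    (hA : 0 < Module.finrank ℂ A) (hB : 0 < Module.finrank ℂ B) {T : Set (A ⊗[ℂ] B)}
    (hT : IsUPB T) :
    ((Module.finrank ℂ A + Module.finrank ℂ B - 1 : ℕ) : ℕ∞) ≤ T.encard := by
  classical
  by_contra! hlt
  have hfin : T.Finite := Set.finite_of_encard_le_coe hlt.le
  lift T to Finset (A ⊗[ℂ] B) using hfin
  rw [Set.encard_coe_eq_coe_finsetCard, Nat.cast_lt] at hlt
  have hprod : ∀ ψ : A ⊗[ℂ] B, ∃ uv : A × B, ψ ∈ T → ψ = uv.1 ⊗ₜ[ℂ] uv.2 := by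
    intro ψ
    by_cases hψ : ψ ∈ T
    · obtain ⟨-, u, v, h⟩ := hT.1.1.1 ψ hψ
      exact ⟨(u, v), fun _ => h⟩
    · exact ⟨0, fun h => absurd h hψ⟩
  choose g hg using hprod
  -- With `dim A - 1` members in `T₁`, or all of `T` if it is smaller, at most `dim B - 1` remain.
  obtain ⟨T₁, hT₁, hcard⟩ := T.exists_subset_card_eq
    (n := min T.card (Module.finrank ℂ A - 1)) (min_le_left _ _)
  have hcard₂ := Finset.card_sdiff_add_card_eq_card hT₁
  obtain ⟨u, hu0, hu⟩ := exists_ne_zero_forall_inner_eq_zero T₁ (fun ψ => (g ψ).1) (by omega)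
  obtain ⟨v, hv0, hv⟩ := exists_ne_zero_forall_inner_eq_zero (T \ T₁) (fun ψ => (g ψ).2) (by omega)
  refine hT.2 (u ⊗ₜ[ℂ] v) (mem_complementarySubspace_iff.2 fun ψ hψ => ?_)
    ⟨tmul_ne_zero_of_ne_zero hu0 hv0, u, v, rfl⟩
  rw [hg ψ hψ, TensorProduct.inner_tmul]
  by_cases h1 : ψ ∈ T₁
  · rw [hu ψ h1, zero_mul]
  · rw [hv ψ (Finset.mem_sdiff.2 ⟨hψ, h1⟩), mul_zero]

/-- A product basis that does not span, with no product state in its complementary subspace,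
is a UPB. -/
theorem isUPB_of_forall_not_isProductState [FiniteDimensional ℂ A] [FiniteDimensional ℂ B]
    {S : Set (A ⊗[ℂ] B)} (hS : IsPB S)
    (hcard : S.encard < ((Module.finrank ℂ A * Module.finrank ℂ B : ℕ) : ℕ∞))
    (h : ∀ ψ ∈ complementarySubspace S, ¬ IsProductState ψ) : IsUPB S := by
  refine ⟨⟨hS, fun T hT hTPB => ?_⟩, h⟩
  have hempty : T = ∅ := Set.eq_empty_of_forall_notMem fun ψ hψ => h ψ (hT hψ) (hTPB.1 ψ hψ)
  rw [hempty, Set.encard_empty]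
  have hfin : S.Finite := Set.finite_of_encard_le_coe hcard.le
  lift S to Finset (A ⊗[ℂ] B) using hfin
  rw [Set.encard_coe_eq_coe_finsetCard, Nat.cast_lt, ← Module.finrank_tensorProduct] at hcard
  have h1 := (Submodule.span ℂ (S : Set (A ⊗[ℂ] B))).finrank_add_finrank_orthogonal
  have h2 : Module.finrank ℂ (Submodule.span ℂ (S : Set (A ⊗[ℂ] B))) ≤ _ :=
    finrank_span_finset_le_card S
  rw [complementarySubspace]
  exact_mod_cast (by omega : 0 < Module.finrank ℂ ((Submodule.span ℂ (S : Set (A ⊗[ℂ] B)))ᗮ :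
    Submodule ℂ (A ⊗[ℂ] B)))

end UnextendibleProductBases

-- The quadratic residue states form a minimal UPB

section QuadraticResidueUPB

variable {p : ℕ} [hp : Fact p.Prime]

theorem ketQ_none (N : ℝ) (a : ZMod p) : ketQ p N a none = N := by
  simp [ketQ]

theorem ketQ_some (N : ℝ) (a : ZMod p) (q : QuadRes p) :
    ketQ p N a (some q) = expMod p (q * a) := by
  simp [ketQ, Pi.single_apply]

theorem inner_ketQ_ketQ (N : ℝ) (a b : ZMod p) :
    inner ℂ (ketQ p N a) (ketQ p N b) = (N : ℂ) ^ 2 + residueSum p (b - a) := by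
  rw [PiLp.inner_apply, Fintype.sum_option, residueSum]
  simp only [ketQ_none, ketQ_some, RCLike.inner_apply, expMod_eq_stdAddChar,
    ← AddChar.map_neg_eq_conj, ← AddChar.map_add_eq_mul]
  simp [mul_add, pow_two, sub_eq_add_neg]

theorem ketQ_ne_zero {N : ℝ} (hN : N ≠ 0) (a : ZMod p) : ketQ p N a ≠ 0 := by
  intro h
  have := ketQ_none N a
  rw [h] at this
  exact hN (by simpa using this.symm)

theorem finrank_localSpace : Module.finrank ℂ (LocalSpace p) = Fintype.card (QuadRes p) + 1 := by
  simp

/-- Any `n` of the states `|Q(a)⟩` span the local space. -/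
theorem eq_zero_of_forall_inner_ketQ_eq_zero {N : ℝ} (hN : N ≠ 0) (A : Finset (ZMod p))
    (hA : Fintype.card (QuadRes p) + 1 ≤ A.card) (u : LocalSpace p)
    (h : ∀ a ∈ A, inner ℂ (ketQ p N a) u = 0) : u = 0 := by
  classical
  -- The entry `N` plays the role of frequency `0`, which is not in `Q_p`; its weight is absorbed
  -- into `w`. Conjugation in the inner product explains the negated set `A.image Neg.neg` below.
  let ι : Option (QuadRes p) → ZMod p := fun o => o.elim 0 fun q => q
  have hι : Function.Injective ι := by
    rintro (_ | q) (_ | r) hqr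
    · rfl
    · exact absurd hqr.symm r.2.1
    · exact absurd hqr q.2.1
    · exact congrArg some (Subtype.ext hqr)
  let w : Option (QuadRes p) → ℂ := fun o => o.elim (N * u none) fun q => u (some q)
  have hw := eq_zero_of_forall_sum_stdAddChar_eq_zero (Finset.univ.image ι) (A.image Neg.neg)
    (by
      rw [Finset.card_image_of_injective _ hι, Finset.card_image_of_injective _ neg_injective]
      simpa using hA)
    (Function.extend ι w 0) (by
      simp only [Finset.mem_image, forall_exists_index, and_imp, forall_apply_eq_imp_iff₂]
      intro a ha
      rw [Finset.sum_image hι.injOn, ← h a ha, PiLp.inner_apply]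
      refine Finset.sum_congr rfl fun o _ => ?_
      rw [hι.extend_apply, RCLike.inner_apply]
      cases o with
      | none => simp [ι, w, ketQ_none, mul_comm]
      | some q =>
        rw [ketQ_some, expMod_eq_stdAddChar, ← AddChar.map_neg_eq_conj]
        simp [ι, w])
  ext o
  have ho := hw (ι o) (Finset.mem_image_of_mem ι (Finset.mem_univ o))
  rw [hι.extend_apply] at ho
  cases o with
  | none => simpa [w, hN] using ho
  | some q => simpa [w] using ho

theorem inner_tmul_ketQ_eq_zero {N : ℝ} (hN : SolvesOrthogonality p N) {x : ZMod p}
    (hx : ¬ IsSquare x) {a b : ZMod p} (hab : a ≠ b) :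
    inner ℂ (ketQ p N a ⊗ₜ[ℂ] ketQ p N (x * a)) (ketQ p N b ⊗ₜ[ℂ] ketQ p N (x * b)) = 0 := by
  rw [TensorProduct.inner_tmul, inner_ketQ_ketQ, inner_ketQ_ketQ, ← mul_sub, ← hN a b hab]
  linear_combination ((N : ℂ) ^ 2 + residueSum p (b - a)) *
    residueSum_add_residueSum_mul hx (sub_ne_zero.2 hab.symm)

theorem tmul_ketQ_injective {N : ℝ} (hN0 : N ≠ 0) (hN : SolvesOrthogonality p N) {x : ZMod p}
    (hx : ¬ IsSquare x) :
    Function.Injective fun a : ZMod p => ketQ p N a ⊗ₜ[ℂ] ketQ p N (x * a) := by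
  intro a b h
  by_contra hab
  have h0 := inner_tmul_ketQ_eq_zero hN hx hab
  rw [← show ketQ p N a ⊗ₜ[ℂ] ketQ p N (x * a) = ketQ p N b ⊗ₜ[ℂ] ketQ p N (x * b) from h]
    at h0
  exact tmul_ne_zero_of_ne_zero (ketQ_ne_zero hN0 _) (ketQ_ne_zero hN0 _)
    ((inner_self_eq_zero (𝕜 := ℂ)).1 h0)

theorem isPB_quadResStates {N : ℝ} (hN0 : N ≠ 0) (hN : SolvesOrthogonality p N) {x : ZMod p}
    (hx : ¬ IsSquare x) : IsPB (quadResStates p N x) := by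
  refine ⟨?_, ?_⟩
  · rintro _ ⟨a, rfl⟩
    exact ⟨tmul_ne_zero_of_ne_zero (ketQ_ne_zero hN0 _) (ketQ_ne_zero hN0 _), _, _, rfl⟩
  · rintro _ ⟨a, rfl⟩ _ ⟨b, rfl⟩ hab
    exact inner_tmul_ketQ_eq_zero hN hx fun h => hab (by rw [h])

theorem not_isProductState_of_mem_complementarySubspace_quadResStates (hp2 : p ≠ 2) {N : ℝ}
    (hN0 : N ≠ 0) {x : ZMod p} (hx0 : x ≠ 0) (ψ : LocalSpace p ⊗[ℂ] LocalSpace p)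
    (hψ : ψ ∈ complementarySubspace (quadResStates p N x)) : ¬ IsProductState ψ := by
  classical
  rintro ⟨hne, u, v, rfl⟩
  rw [mem_complementarySubspace_iff] at hψ
  have hcard := two_mul_card_quadRes_add_one hp2
  let s : Finset (ZMod p) := {a | inner ℂ (ketQ p N a) u = 0}
  have hs : s.card + sᶜ.card = p := by rw [Finset.card_add_card_compl, ZMod.card]
  -- Pigeonhole: of `s` and its complement in `2n - 1` elements, one has at least `n`.
  by_cases hsc : Fintype.card (QuadRes p) + 1 ≤ s.card
  · refine hne ?_
    rw [eq_zero_of_forall_inner_ketQ_eq_zero hN0 s hsc u fun a ha => (Finset.mem_filter.1 ha).2,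
      TensorProduct.zero_tmul]
  · refine hne ?_
    rw [eq_zero_of_forall_inner_ketQ_eq_zero hN0 (sᶜ.image (x * ·)) ?_ v ?_,
      TensorProduct.tmul_zero]
    · rw [Finset.card_image_of_injective _ (mul_right_injective₀ hx0)]
      omega
    · simp only [Finset.mem_image, forall_exists_index, and_imp, forall_apply_eq_imp_iff₂]
      intro a ha
      have h0 := hψ _ ⟨a, rfl⟩
      rw [TensorProduct.inner_tmul] at h0
      exact (mul_eq_zero.1 h0).resolve_left fun h => Finset.mem_compl.1 ha (by simpa [s] using h)

theorem encard_quadResStates {N : ℝ} (hN0 : N ≠ 0) (hN : SolvesOrthogonality p N) {x : ZMod p}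
    (hx : ¬ IsSquare x) : (quadResStates p N x).encard = p := by
  rw [quadResStates, ← Set.image_univ, (tmul_ketQ_injective hN0 hN hx).encard_image,
    Set.encard_univ, ENat.card_eq_coe_fintype_card, ZMod.card]

theorem isMinimalUPB_quadResStates (hp3 : 3 < p) {N : ℝ} (hN0 : N ≠ 0)
    (hN : SolvesOrthogonality p N) {x : ZMod p} (hx : ¬ IsSquare x) :
    IsMinimalUPB (quadResStates p N x) := by
  have hp2 : p ≠ 2 := by omega
  have hcard := two_mul_card_quadRes_add_one hp2
  have hx0 : x ≠ 0 := fun h => hx (h ▸ IsSquare.zero)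
  refine ⟨isUPB_of_forall_not_isProductState (isPB_quadResStates hN0 hN hx) ?_
    (not_isProductState_of_mem_complementarySubspace_quadResStates hp2 hN0 hx0), fun T hT => ?_⟩
  · rw [encard_quadResStates hN0 hN hx, finrank_localSpace, Nat.cast_lt]
    nlinarith
  · have h := hT.finrank_add_finrank_le_encard (by simp) (by simp)
    rw [encard_quadResStates hN0 hN hx]
    rw [finrank_localSpace] at h
    exact le_trans (by exact_mod_cast (by omega)) h

end QuadraticResidueUPB

theorem theorem7 (n p : ℕ) [Fact p.Prime] (hpn : p = 2 * n - 1) (hp4 : p % 4 = 1) :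
    Module.finrank ℂ (LocalSpace p) = n ∧
    (∃ N : ℝ, SolvesOrthogonality p N) ∧
    ∀ N : ℝ, SolvesOrthogonality p N →
      ∀ x : ZMod p, x ≠ 0 → ¬ IsSquare x →
        (quadResStates p N x).encard = p ∧ IsMinimalUPB (quadResStates p N x) := by
  have hp1 := (Fact.out : p.Prime).one_lt
  have hcard := two_mul_card_quadRes_add_one (p := p) (by omega)
  refine ⟨?_, exists_solvesOrthogonality hp4, fun N hN x _ hx => ?_⟩
  · rw [finrank_localSpace]
    omega
  · have hN0 := hN.ne_zero hp4
    exact ⟨encard_quadResStates hN0 hN hx,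
      isMinimalUPB_quadResStates (by omega) hN0 hN hx⟩
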